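/- Let $K_m$ denote the complete graph on $m$ vertices (without loops) and let $K^*_m$ denote the complete graph on $m$ vertices with a loop added at every vertex. For graphs $G,H$ (loops allowed), the tensor product $G\otimes H$ is the graph with vertex set $V(G)\times V(H)$ in which $(u,u')$ and $(v,v')$ are adjacent if and only if $u$ is adjacent to $v$ in $G$ and $u'$ is adjacent to $v'$ in $H$. A graph is called circulant if, for some integer $N\ge 1$ and some $S\subseteq \mathbb{Z}/N\mathbb{Z}$ with $S=-S$ and $0\notin S$, it is isomorphic to the graph on $\mathbb{Z}/N\mathbb{Z}$ in which $i$ and $j$ are adjacent if and only if $i-j\in S$. Theorem 4.2. Let $n$ be an even positive integer, let $2^{\alpha_1}$ be the highest power of $2$ dividing $n$, and let $d=n/2^{\alpha_1}$ be the odd part of $n$. If $d>1$ (that is, if $n$ is not a power of $2$), then the graph $$\bigl(K_d\otimes K^*_{n/d}\bigr)\otimes\bigl(K_d\otimes K^*_{n/d}\bigr)$$ is not a circulant graph. -/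

import Mathlib

/-- An undirected graph without multiple edges on the vertex set `V`, in which loops are allowed:
a symmetric adjacency relation. -/
@[ext]
structure LoopGraph (V : Type*) where
  /-- The adjacency relation; `Adj v v` means that there is a loop at `v`. -/
  Adj : V → V → Prop
  symm : ∀ u v, Adj u v → Adj v u

namespace LoopGraph

/-- A simple graph (no loops), seen as a graph in which loops would be allowed. -/
def ofSimple {V : Type*} (G : SimpleGraph V) : LoopGraph V where
  Adj := G.Adj
  symm _ _ h := SimpleGraph.Adj.symm h

/-- The complete graph `K_m` on `m` vertices, without loops. -/
def complete (m : ℕ) : LoopGraph (Fin m) :=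
  ofSimple (SimpleGraph.completeGraph (Fin m))

/-- The graph `K*_m`: the complete graph on `m` vertices with a loop at every vertex. -/
def completeLoops (m : ℕ) : LoopGraph (Fin m) where
  Adj u v := (SimpleGraph.completeGraph (Fin m)).Adj u v ∨ u = v
  symm _ _ h := h.imp (fun h => h.symm) (fun h => h.symm)

/-- The tensor product `G ⊗ H`: `(u, u')` and `(v, v')` are adjacent if and only if `u` is adjacent
to `v` in `G` and `u'` is adjacent to `v'` in `H`. -/
def tensor {V W : Type*} (G : LoopGraph V) (H : LoopGraph W) : LoopGraph (V × W) where
  Adj x y := G.Adj x.1 y.1 ∧ H.Adj x.2 y.2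
  symm _ _ h := ⟨G.symm _ _ h.1, H.symm _ _ h.2⟩

/-- A graph is circulant if it is isomorphic to a graph `G(N; S)` on the vertex set `ZMod N`, where
`N ≥ 1`, the symbol `S` satisfies `S = -S` and `0 ∉ S`, and vertices `i`, `j` are adjacent if and
only if `i - j ∈ S`. -/
def IsCirculant {V : Type*} (G : LoopGraph V) : Prop :=
  ∃ N : ℕ, 0 < N ∧ ∃ S : Set (ZMod N), (∀ s, s ∈ S ↔ -s ∈ S) ∧ (0 : ZMod N) ∉ S ∧
    Nonempty (G.Adj ≃r fun i j : ZMod N => i - j ∈ S)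

end LoopGraph

/-! Non-adjacency in the graph means sharing a row or a column of a `d × d` grid with cells of size
`k`. A circulant structure makes this relation translation invariant on `ZMod N`. Cliques of the
relation lie in lines, so moving an element of the row of `0` to `0` sends that row to the row or to
the column of `0` (`row_translate`). If the second case occurred, the row stabilizer would be half
the row; as it contains a subgroup of order `k`, `d` would be even. So the row and, by symmetry, the
column are subgroups of order `d * k`. A cyclic group has only one such subgroup, but row and column
differ. -/

/-- Two maps `p`, `q` from an additive group to `Fin d` that arrange it as a `d × d` grid with
cells of size `k`, such that the relation of sharing a row or a column is translation invariant. -/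
structure TranslationGrid {G : Type*} [AddCommGroup G] {d : ℕ} (k : ℕ) (p q : G → Fin d) :
    Prop where
  card_cell : ∀ a b, Nat.card {x // p x = a ∧ q x = b} = k
  translate : ∀ x y t, (p (x + t) = p (y + t) ∨ q (x + t) = q (y + t)) ↔ (p x = p y ∨ q x = q y)

namespace TranslationGrid

/-- A set in which any two elements share a row or a column lies in a single row or column. -/
theorem clique_subset_line {G P Q : Type*} {p : G → P} {q : G → Q} {C : Set G}
    (hC : ∀ x ∈ C, ∀ y ∈ C, p x = p y ∨ q x = q y) :
    (∀ x ∈ C, ∀ y ∈ C, p x = p y) ∨ (∀ x ∈ C, ∀ y ∈ C, q x = q y) := by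
  by_contra! h
  obtain ⟨⟨u, hu, v, hv, huv⟩, ⟨x, hx, y, hy, hxy⟩⟩ := h
  -- `u` and `v` lie in different rows, hence in one column; `w` cannot share a row with both.
  have hq : ∀ w ∈ C, q w = q u := by
    intro w hw
    have h1 := hC w hw u hu
    have h2 := hC w hw v hv
    have h3 := hC u hu v hv
    grind
  exact hxy ((hq x hx).trans (hq y hy).symm)

variable {G : Type*} [AddCommGroup G] {d k : ℕ} {p q : G → Fin d}

theorem swap (h : TranslationGrid k p q) : TranslationGrid k q p where
  card_cell a b := by simpa only [and_comm] using h.card_cell b a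
  translate x y t := by simpa only [or_comm] using h.translate x y t

theorem exists_mem_cell (h : TranslationGrid k p q) (hk : 0 < k) (a b : Fin d) :
    ∃ x, p x = a ∧ q x = b := by
  have := h.card_cell a b
  obtain ⟨⟨x, hx⟩⟩ := (Nat.card_pos_iff.mp (this ▸ hk)).1
  exact ⟨x, hx⟩

theorem card_row [Finite G] (h : TranslationGrid k p q) (a : Fin d) :
    Nat.card {x // p x = a} = d * k := by
  have e : {x // p x = a} ≃ Σ b : Fin d, {x // p x = a ∧ q x = b} :=
    (Equiv.sigmaFiberEquiv fun x : {x // p x = a} => q x).symm.trans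
      (Equiv.sigmaCongrRight fun b => Equiv.subtypeSubtypeEquivSubtypeInter _ fun x => q x = b)
  rw [Nat.card_congr e, Nat.card_sigma]
  simp [h.card_cell]

theorem exists_ne_ne (hd : 3 ≤ d) (a b : Fin d) : ∃ c, c ≠ a ∧ c ≠ b := by
  obtain ⟨c, hc⟩ := Finset.exists_mem_notMem_of_card_lt_card (s := {a, b}) (t := Finset.univ)
    (by rw [Finset.card_univ, Fintype.card_fin]; exact Finset.card_le_two.trans_lt hd)
  exact ⟨c, by simpa using hc.2⟩

/-- Elements with the same neighbours lie in the same row. -/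
theorem row_eq_of_twins (h : TranslationGrid k p q) (hk : 0 < k) (hd : 3 ≤ d) {u v : G}
    (huv : ∀ z, (p u = p z ∨ q u = q z) ↔ (p v = p z ∨ q v = q z)) : p u = p v := by
  -- A point of the row of `u` outside the column of `v` can only be a neighbour of `v` through its
  -- row.
  obtain ⟨c, hcu, hcv⟩ := exists_ne_ne hd (q u) (q v)
  obtain ⟨z, hz1, hz2⟩ := h.exists_mem_cell hk (p u) c
  have := huv z
  grind

/-- The translations that preserve the row of `0`. -/
def rowStabilizer (p : G → Fin d) : AddSubgroup G where
  carrier := {x | ∀ y, p (y + x) = p 0 ↔ p y = p 0}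
  zero_mem' := by simp
  add_mem' {a b} ha hb y := by rw [← add_assoc, hb, ha]
  neg_mem' {a} ha y := by simpa using (ha (y + -a)).symm

/-- The translations that move every element inside its cell. -/
def twinSubgroup (p q : G → Fin d) : AddSubgroup G where
  carrier := {t | ∀ x, p (x + t) = p x ∧ q (x + t) = q x}
  zero_mem' := by simp
  add_mem' {a b} ha hb y := by
    rw [← add_assoc]; exact ⟨(hb _).1.trans (ha _).1, (hb _).2.trans (ha _).2⟩
  neg_mem' {a} ha y := by
    have := ha (y + -a)
    rw [neg_add_cancel_right] at this
    exact ⟨this.1.symm, this.2.symm⟩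

theorem twinSubgroup_le_rowStabilizer : twinSubgroup p q ≤ rowStabilizer p :=
  fun t ht y => by rw [(ht y).1]

/-- By invariance, if `t` and `0` are twins then so are `x + t` and `x`, and twins share a cell. -/
theorem mem_twinSubgroup (h : TranslationGrid k p q) (hk : 0 < k) (hd : 3 ≤ d) {t : G} :
    t ∈ twinSubgroup p q ↔ p t = p 0 ∧ q t = q 0 := by
  refine ⟨fun ht => by simpa using ht 0, fun ⟨hp, hq⟩ x => ?_⟩
  have key : ∀ z, (p (x + t) = p z ∨ q (x + t) = q z) ↔ (p x = p z ∨ q x = q z) := by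
    intro z
    have h1 := h.translate t (z - x) x
    have h2 := h.translate 0 (z - x) x
    rw [sub_add_cancel, add_comm t x] at h1
    rw [sub_add_cancel, zero_add] at h2
    rw [h1, h2, hp, hq]
  exact ⟨h.row_eq_of_twins hk hd key,
    h.swap.row_eq_of_twins hk hd fun z => by simpa only [or_comm] using key z⟩

theorem card_twinSubgroup (h : TranslationGrid k p q) (hk : 0 < k) (hd : 3 ≤ d) :
    Nat.card (twinSubgroup p q) = k := by
  rw [← h.card_cell (p 0) (q 0)]
  exact Nat.card_congr (Equiv.subtypeEquivRight fun t => h.mem_twinSubgroup hk hd)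

theorem mem_row_of_mem_rowStabilizer {x : G} (hx : x ∈ rowStabilizer p) : p x = p 0 := by
  simpa using hx 0

/-- A translation carrying a finite set into another one of the same size carries it onto that set. -/
theorem mem_iff_of_card_eq [Finite G] {A B : Set G} (x : G) (hAB : Nat.card A = Nat.card B)
    (hsub : ∀ y ∈ A, y - x ∈ B) (y : G) : y ∈ A ↔ y - x ∈ B := by
  refine ⟨hsub y, fun hy => ?_⟩
  have hinj : Function.Injective (fun a : A => (⟨a - x, hsub a a.2⟩ : B)) := fun a b hab => by
    simpa [Subtype.ext_iff] using hab
  obtain ⟨a, ha⟩ := ((Nat.bijective_iff_injective_and_card _).2 ⟨hinj, hAB⟩).2 ⟨_, hy⟩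
  have : (a : G) = y := by simpa [Subtype.ext_iff] using ha
  exact this ▸ a.2

/-- A translation taking an element of the row of `0` to `0` maps this row to the row or to the
column of `0`. -/
theorem row_translate [Finite G] (h : TranslationGrid k p q) {x : G} (hx : p x = p 0) :
    (∀ y, p y = p 0 ↔ p (y - x) = p 0) ∨ (∀ y, p y = p 0 ↔ q (y - x) = q 0) := by
  have hclique := clique_subset_line (p := fun y => p (y - x)) (q := fun y => q (y - x))
    (C := {y | p y = p 0}) fun y hy z hz => by
      simpa only [sub_eq_add_neg] using (h.translate y z (-x)).2 (.inl (hy.trans hz.symm))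
  refine hclique.imp (fun hc => ?_) fun hc => ?_
  · refine mem_iff_of_card_eq (A := {y | p y = p 0}) (B := {y | p y = p 0}) x rfl fun y hy => ?_
    simpa using hc y hy x hx
  · refine mem_iff_of_card_eq (A := {y | p y = p 0}) (B := {y | q y = q 0}) x
      ((h.card_row _).trans (h.swap.card_row _).symm) fun y hy => ?_
    simpa using hc y hy x hx

/-- The row of `0` is the subgroup `rowStabilizer p`, if `d` is odd. -/
theorem mem_rowStabilizer [Finite G] (h : TranslationGrid k p q) (hk : 0 < k) (hd : 3 ≤ d)
    (hodd : Odd d) {x : G} : x ∈ rowStabilizer p ↔ p x = p 0 := by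
  refine ⟨mem_row_of_mem_rowStabilizer, fun hx => ?_⟩
  by_contra hxH
  have hcol : ∀ z, p z = p 0 → z ∉ rowStabilizer p → ∀ y, p y = p 0 ↔ q (y - z) = q 0 := by
    intro z hz hzH
    refine (h.row_translate hz).resolve_left fun hc => hzH fun y => ?_
    rw [hc, add_sub_cancel_right]
  -- Translations by `-z` and `-x` both carry the row of `0` onto its column, so `z - x` stabilizes
  -- the row: the exceptional elements form one coset.
  have hcoset : ∀ z, (p z = p 0 ∧ z ∉ rowStabilizer p) ↔ z - x ∈ rowStabilizer p := by
    intro z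
    refine ⟨fun ⟨hz, hzH⟩ y => ?_, fun hz => ⟨?_, fun hzH => hxH ?_⟩⟩
    · rw [hcol z hz hzH, hcol x hx hxH]
      rw [show y + (z - x) - z = y - x by abel]
    · have := hz x
      rw [add_sub_cancel] at this
      exact this.2 hx
    · simpa using sub_mem hzH hz
  have e1 : {z : {z // p z = p 0} // (z : G) ∈ rowStabilizer p} ≃ rowStabilizer p :=
    (Equiv.subtypeSubtypeEquivSubtype fun hz => mem_row_of_mem_rowStabilizer hz)
  have e2 : {z : {z // p z = p 0} // (z : G) ∉ rowStabilizer p} ≃ rowStabilizer p :=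
    (Equiv.subtypeSubtypeEquivSubtypeInter _ fun z => z ∉ rowStabilizer p).trans
      ((Equiv.subRight x).subtypeEquiv hcoset)
  classical
  have hcard : d * k = 2 * Nat.card (rowStabilizer p) := by
    rw [← h.card_row (p 0), ← Nat.card_congr (Equiv.sumCompl
      fun z : {z // p z = p 0} => (z : G) ∈ rowStabilizer p), Nat.card_sum,
      Nat.card_congr e1, Nat.card_congr e2, two_mul]
  obtain ⟨c, hc⟩ := AddSubgroup.card_dvd_of_le (twinSubgroup_le_rowStabilizer (p := p) (q := q))
  rw [h.card_twinSubgroup hk hd] at hc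
  have : d = 2 * c := Nat.eq_of_mul_eq_mul_right hk (by rw [hcard, hc]; ring)
  exact Nat.not_even_iff_odd.2 hodd (this ▸ even_two_mul c)

/-- The right-hand side does not mention `p`, so it describes the column of `0` equally well.
Equality holds by counting: a cyclic group has at most `d * k` solutions. -/
theorem mem_row_iff_nsmul_eq_zero [Finite G] [IsAddCyclic G] (h : TranslationGrid k p q)
    (hk : 0 < k) (hd : 3 ≤ d) (hodd : Odd d) (x : G) : p x = p 0 ↔ (d * k) • x = 0 := by
  classical
  have := Fintype.ofFinite G
  have hcard : Nat.card (rowStabilizer p) = d * k := by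
    rw [← h.card_row (p 0)]
    exact Nat.card_congr (Equiv.subtypeEquivRight fun x => h.mem_rowStabilizer hk hd hodd)
  have heq : (Finset.univ.filter fun x => p x = p 0) =
      Finset.univ.filter fun x : G => (d * k) • x = 0 := by
    refine Finset.eq_of_subset_of_card_le (fun y hy => ?_) ?_
    · simp only [Finset.mem_filter, Finset.mem_univ, true_and] at hy ⊢
      rw [← hcard]
      exact congrArg Subtype.val (card_nsmul_eq_zero'
        (x := (⟨y, (h.mem_rowStabilizer hk hd hodd).2 hy⟩ : rowStabilizer p)))
    · rw [← Fintype.card_subtype fun x => p x = p 0, ← Nat.card_eq_fintype_card, h.card_row]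
      exact IsAddCyclic.card_nsmul_eq_zero_le (by positivity)
  simpa using Finset.ext_iff.1 heq x

/-- A finite cyclic group carries no translation-invariant grid with an odd number `d > 1` of
rows. -/
theorem false_of_isAddCyclic [Finite G] [IsAddCyclic G] (h : TranslationGrid k p q)
    (hk : 0 < k) (hd : 3 ≤ d) (hodd : Odd d) : False := by
  obtain ⟨c, hc, -⟩ := exists_ne_ne hd (q 0) (q 0)
  obtain ⟨x, hx1, hx2⟩ := h.exists_mem_cell hk (p 0) c
  have := (h.swap.mem_row_iff_nsmul_eq_zero hk hd hodd x).2
    ((h.mem_row_iff_nsmul_eq_zero hk hd hodd x).1 hx1)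
  exact hc (hx2.symm.trans this)

end TranslationGrid

namespace LoopGraph

theorem completeLoops_adj {m : ℕ} (u v : Fin m) : (completeLoops m).Adj u v := by
  by_cases h : u = v
  · exact .inr h
  · exact .inl h

theorem tensor_complete_completeLoops_adj {d m : ℕ} (x y : (Fin d × Fin m) × (Fin d × Fin m)) :
    (((complete d).tensor (completeLoops m)).tensor ((complete d).tensor (completeLoops m))).Adj
      x y ↔ x.1.1 ≠ y.1.1 ∧ x.2.1 ≠ y.2.1 :=
  ⟨fun h => ⟨h.1.1, h.2.1⟩, fun h => ⟨⟨h.1, completeLoops_adj _ _⟩, ⟨h.2, completeLoops_adj _ _⟩⟩⟩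

theorem not_isCirculant_of_odd {d m : ℕ} (hd : 1 < d) (hodd : Odd d) (hm : 0 < m) :
    ¬ (((complete d).tensor (completeLoops m)).tensor
        ((complete d).tensor (completeLoops m))).IsCirculant := by
  rintro ⟨N, hN, S, -, -, ⟨φ⟩⟩
  have : NeZero N := ⟨hN.ne'⟩
  have hR : ∀ x y : ZMod N, ((φ.symm x).1.1 = (φ.symm y).1.1 ∨ (φ.symm x).2.1 = (φ.symm y).2.1) ↔
      x - y ∉ S := by
    intro x y
    rw [← φ.symm.map_rel_iff, tensor_complete_completeLoops_adj]
    tauto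
  have hgrid : TranslationGrid (m * m) (fun x => (φ.symm x).1.1) (fun x => (φ.symm x).2.1) :=
    { card_cell := fun a b => by
        let e : Fin m × Fin m ≃ {x // (φ.symm x).1.1 = a ∧ (φ.symm x).2.1 = b} :=
          { toFun := fun c => ⟨φ ((a, c.1), (b, c.2)), by simp⟩
            invFun := fun x => ((φ.symm x).1.2, (φ.symm x).2.2)
            left_inv := fun c => by simp
            right_inv := by
              rintro ⟨x, rfl, rfl⟩
              simp }
        rw [← Nat.card_congr e]
        simp
      translate := fun x y t => by rw [hR, hR, add_sub_add_right_eq_sub] }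
  obtain ⟨c, rfl⟩ := hodd
  exact hgrid.false_of_isAddCyclic (Nat.mul_pos hm hm) (by omega) ⟨c, rfl⟩

end LoopGraph

theorem theorem4p2 (n d : ℕ) (hn : Even n) (hd : d = n / 2 ^ n.factorization 2) (hd1 : 1 < d) :
    ¬ (((LoopGraph.complete d).tensor (LoopGraph.completeLoops (n / d))).tensor
        ((LoopGraph.complete d).tensor (LoopGraph.completeLoops (n / d)))).IsCirculant := by
  have hn0 : n ≠ 0 := by
    rintro rfl
    -- For `n = 0`, `hd` gives `d = 0`.
    simp at hd
    omega
  have hdvd : d ∣ n := hd ▸ Nat.ordCompl_dvd n 2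
  refine LoopGraph.not_isCirculant_of_odd hd1 ?_
    (Nat.div_pos (Nat.le_of_dvd (Nat.pos_of_ne_zero hn0) hdvd) (by omega))
  have := Nat.not_dvd_ordCompl Nat.prime_two hn0
  rw [← hd] at this
  rwa [← Nat.not_even_iff_odd, even_iff_two_dvd]
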